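/- Let $m \ge 5$ be an integer and let $A_m$ denote the alternating group of degree $m$. Then there exist primes $p$ and $q$ with $m/2 \le p < q \le m$, where moreover $m/2 < p$ unless $m \in \{6, 10\}$, such that for all $x, y \in A_m$ with $|x| = p$ and $|y| = q$ (element orders), the subgroup $\langle x, y\rangle$ is isomorphic to the alternating group $A_d$ for some integer $d \ge 5$ (depending on $x$ and $y$). In particular, $\langle x, y\rangle$ is nonsolvable. -/

import Mathlib

/-!
The proof of Bertrand's postulate, which bounds `centralBinom n` from above, in fact yields three
primes in `(n, 2n]`, and hence primes `p < q` with `q - p ≥ 3` in the upper half once `m ≥ 17`.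

Replace the degree by the number `d` of points moved by `x` or `y`. Then `⟨x, y⟩` is transitive and,
because `y` is a `q`-cycle with `2 * q > d`, even primitive. If `x` is a `p`-cycle fixing at least
three points, Jordan's theorem says that `⟨x, y⟩` contains `A_d`: the group is `(d - p + 1)`-fold
transitive, so that by Sylow's theorem every permutation of the fixed points of `x` is induced by an
element normalizing `⟨x⟩`. A commutator of two such elements centralizes `x`, because `Aut ⟨x⟩` is
abelian, and a suitable power of it is trivial on the support of `x` and a 3-cycle off it.

A gap `q - p ≥ 3` leaves three fixed points. The pairs `(3, 5)`, `(5, 7)` and `(11, 13)` need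
separate arguments. In degrees 6 and 7 multiple transitivity bounds `|⟨x, y⟩|` from below, and the
index in `A_d` is at most 6 because a group generated by elements of odd order cannot have
order `2 * k` with `k` odd. In degree 13 it is enough that 5 divides the order: if it did not, then
in the stabilizer of a fixed point of `x` the Sylow 11-subgroup would be central in its normalizer,
and its normal complement would contain a nontrivial 2-group on which an element of order 11 acts
without nontrivial fixed points, although `2 ^ i ≢ 1` modulo 11 for `0 < i < 10`.
-/

open Equiv Equiv.Perm MulAction

/-! ### Primes in the upper half of an interval -/

theorem pow_factorization_centralBinom_le {n p : ℕ} (hn : 2 < n) (hp : p ≤ 2 * n) :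
    p ^ n.centralBinom.factorization p ≤
      (if p ∈ (Finset.Ioc n (2 * n)).filter Nat.Prime ∪ Finset.Icc 1 (2 * n).sqrt
        then 2 * n else 1) * (if p < 2 * n / 3 + 1 ∧ p.Prime then p else 1) := by
  have h_one_le : 1 ≤ if p < 2 * n / 3 + 1 ∧ p.Prime then p else 1 := by
    split_ifs with h
    exacts [h.2.one_le, le_rfl]
  by_cases hpS : p ∈ (Finset.Ioc n (2 * n)).filter Nat.Prime ∪ Finset.Icc 1 (2 * n).sqrt
  · rw [if_pos hpS]
    exact (Nat.pow_factorization_choose_le (by omega)).trans (Nat.le_mul_of_pos_right _ h_one_le)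
  rw [if_neg hpS, one_mul]
  by_cases hp_prime : p.Prime
  · simp only [Finset.mem_union, Finset.mem_filter, Finset.mem_Ioc, Finset.mem_Icc, hp_prime,
      and_true, not_or, not_and, not_le] at hpS
    by_cases hp_small : p < 2 * n / 3 + 1
    · rw [if_pos ⟨hp_small, hp_prime⟩]
      exact (pow_le_pow_right₀ hp_prime.one_le (Nat.factorization_choose_le_one
        (Nat.sqrt_lt'.1 (hpS.2 hp_prime.one_le)))).trans_eq (pow_one p)
    · rw [Nat.factorization_centralBinom_of_two_mul_self_lt_three_mul hn (by omega) (by omega),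
        pow_zero]
      exact h_one_le
  · rw [Nat.factorization_eq_zero_of_not_prime _ hp_prime, pow_zero]
    exact h_one_le

theorem centralBinom_le_pow_card_primes_mul {n : ℕ} (hn : 2 < n) :
    n.centralBinom ≤ (2 * n) ^ ((Finset.Ioc n (2 * n)).filter Nat.Prime).card *
      (2 * n) ^ (2 * n).sqrt * 4 ^ (2 * n / 3) := by
  set S := (Finset.Ioc n (2 * n)).filter Nat.Prime ∪ Finset.Icc 1 (2 * n).sqrt with hS
  have hS_card : S.card ≤ ((Finset.Ioc n (2 * n)).filter Nat.Prime).card + (2 * n).sqrt :=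
    (Finset.card_union_le _ _).trans_eq (by rw [Nat.card_Icc, Nat.add_sub_cancel])
  have hS_range : S ⊆ Finset.range (2 * n + 1) := by
    intro p hp
    have := Nat.sqrt_le_self (2 * n)
    simp only [hS, Finset.mem_union, Finset.mem_filter, Finset.mem_Ioc, Finset.mem_Icc,
      Finset.mem_range] at hp ⊢
    omega
  calc n.centralBinom
      = ∏ p ∈ Finset.range (2 * n + 1), p ^ n.centralBinom.factorization p :=
        (Nat.prod_pow_factorization_centralBinom n).symm
    _ ≤ (∏ p ∈ Finset.range (2 * n + 1), if p ∈ S then 2 * n else 1) *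
          ∏ p ∈ Finset.range (2 * n + 1), if p < 2 * n / 3 + 1 ∧ p.Prime then p else 1 :=
        (Finset.prod_le_prod' fun p hp ↦ pow_factorization_centralBinom_le hn <|
          Nat.lt_succ_iff.1 (Finset.mem_range.1 hp)).trans_eq Finset.prod_mul_distrib
    _ = (2 * n) ^ S.card * primorial (2 * n / 3) := by
        rw [← Finset.prod_filter, ← Finset.prod_filter, Finset.prod_const,
          Finset.filter_mem_eq_inter, Finset.inter_eq_right.2 hS_range, primorial]
        congr 2
        ext p
        simp only [Finset.mem_filter, Finset.mem_range, ← and_assoc, and_congr_left_iff]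
        omega
    _ ≤ _ := by
        rw [← pow_add]
        exact Nat.mul_le_mul (Nat.pow_le_pow_right (by omega) hS_card) (primorial_le_four_pow _)

-- The fourth power of Bertrand's inequality at `x / 4`.
theorem mul_sq_mul_rpow_sqrt_le_four_rpow {x : ℝ} (hx : 2048 ≤ x) :
    x * (2 * x) ^ 2 * (2 * x) ^ √(2 * x) * 4 ^ (2 * x / 3) ≤ 4 ^ x := by
  have h_poly : x * (2 * x) ^ 2 ≤ (x / 4) ^ 4 := by
    nlinarith [mul_nonneg (pow_nonneg (by linarith : 0 ≤ x) 3) (by linarith : 0 ≤ x - 1024)]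
  have h_sqrt : √(2 * (x / 4)) * (4 : ℕ) = 2 * √(2 * x) := by
    rw [show 2 * (x / 4) = 2 * x / 2 ^ 2 by ring, Real.sqrt_div (by linarith),
      Real.sqrt_sq zero_le_two]
    push_cast
    ring
  have h_rpow : (2 * x) ^ √(2 * x) ≤ ((2 * (x / 4)) ^ √(2 * (x / 4))) ^ 4 := by
    rw [← Real.rpow_mul_natCast (by linarith), h_sqrt, Real.rpow_mul (by linarith)]
    refine Real.rpow_le_rpow (by linarith) ?_ (Real.sqrt_nonneg _)
    rw [Real.rpow_two]
    nlinarith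
  have h_four (y : ℝ) : ((4 : ℝ) ^ (y / 4)) ^ 4 = 4 ^ y := by
    rw [← Real.rpow_mul_natCast (by norm_num)]
    congr 1
    push_cast
    ring
  have bertrand := Bertrand.real_main_inequality (x := x / 4) (by linarith)
  calc x * (2 * x) ^ 2 * (2 * x) ^ √(2 * x) * 4 ^ (2 * x / 3)
      ≤ (x / 4) ^ 4 * ((2 * (x / 4)) ^ √(2 * (x / 4))) ^ 4 * (4 ^ (2 * x / 3 / 4)) ^ 4 := by
        rw [h_four]
        gcongr
    _ = (x / 4 * (2 * (x / 4)) ^ √(2 * (x / 4)) * 4 ^ (2 * (x / 4) / 3)) ^ 4 := by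
        rw [mul_pow, mul_pow, show 2 * (x / 4) / 3 = 2 * x / 3 / 4 by ring]
    _ ≤ (4 ^ (x / 4)) ^ 4 := pow_le_pow_left₀ (by positivity) bertrand 4
    _ = 4 ^ x := h_four x

theorem mul_sq_mul_pow_sqrt_le_four_pow {n : ℕ} (hn : 2048 ≤ n) :
    n * (2 * n) ^ 2 * (2 * n) ^ (2 * n).sqrt * 4 ^ (2 * n / 3) ≤ 4 ^ n := by
  rw [← @Nat.cast_le ℝ]
  push_cast
  simp only [← Real.rpow_natCast]
  refine le_trans ?_ (mul_sq_mul_rpow_sqrt_le_four_rpow (x := n) (by exact_mod_cast hn))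
  rw [Nat.cast_ofNat, Real.rpow_two]
  have h_base : (1 : ℝ) ≤ 2 * n := by exact_mod_cast (by omega : 1 ≤ 2 * n)
  gcongr
  · exact Real.nat_sqrt_le_real_sqrt.trans (by push_cast; rfl)
  · norm_num
  · exact Nat.cast_div_le.trans (by push_cast; rfl)

theorem two_lt_card_primes_Ioc {n : ℕ} (hn : 2048 ≤ n) :
    2 < ((Finset.Ioc n (2 * n)).filter Nat.Prime).card := by
  by_contra! h
  refine (mul_sq_mul_pow_sqrt_le_four_pow hn).not_gt ?_
  calc 4 ^ n < n * n.centralBinom := Nat.four_pow_lt_mul_centralBinom n (by omega)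
    _ ≤ n * ((2 * n) ^ 2 * (2 * n) ^ (2 * n).sqrt * 4 ^ (2 * n / 3)) := by
        refine Nat.mul_le_mul_left n
          ((centralBinom_le_pow_card_primes_mul (by omega)).trans ?_)
        gcongr
        omega
    _ = _ := by ring

theorem exists_primes_add_three_le_of_large {m : ℕ} (hm : 4096 ≤ m) :
    ∃ p q : ℕ, p.Prime ∧ q.Prime ∧ m < 2 * p ∧ p + 3 ≤ q ∧ q ≤ m := by
  have mem_Ioc : ∀ p ∈ (Finset.Ioc (m / 2) (2 * (m / 2))).filter Nat.Prime,
      p.Prime ∧ m < 2 * p ∧ p ≤ m ∧ p % 2 = 1 := by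
    intro p hp
    rw [Finset.mem_filter, Finset.mem_Ioc] at hp
    refine ⟨hp.2, ?_⟩
    have := hp.2.eq_two_or_odd
    omega
  obtain ⟨a, ha, b, hb, c, hc, hab, hac, hbc⟩ :=
    Finset.two_lt_card.1 (two_lt_card_primes_Ioc (n := m / 2) (by omega))
  obtain ⟨ha_prime, ha⟩ := mem_Ioc a ha
  obtain ⟨hb_prime, hb⟩ := mem_Ioc b hb
  obtain ⟨hc_prime, hc⟩ := mem_Ioc c hc
  have : a + 3 ≤ b ∨ a + 3 ≤ c ∨ b + 3 ≤ a ∨ b + 3 ≤ c ∨ c + 3 ≤ a ∨ c + 3 ≤ b := by omega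
  rcases this with h | h | h | h | h | h
  exacts [⟨a, b, ha_prime, hb_prime, ha.1, h, hb.2.1⟩, ⟨a, c, ha_prime, hc_prime, ha.1, h, hc.2.1⟩,
    ⟨b, a, hb_prime, ha_prime, hb.1, h, ha.2.1⟩, ⟨b, c, hb_prime, hc_prime, hb.1, h, hc.2.1⟩,
    ⟨c, a, hc_prime, ha_prime, hc.1, h, ha.2.1⟩, ⟨c, b, hc_prime, hb_prime, hc.1, h, hb.2.1⟩]

theorem exists_primes_add_three_le {m : ℕ} (hm : 17 ≤ m) :
    ∃ p q : ℕ, p.Prime ∧ q.Prime ∧ m < 2 * p ∧ p + 3 ≤ q ∧ q ≤ m := by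
  rcases le_or_gt 4096 m with hm_large | hm_small
  · exact exists_primes_add_three_le_of_large hm_large
  let pairs : List (ℕ × ℕ) := [(11, 17), (13, 19), (17, 23), (23, 31), (37, 43), (61, 71),
    (109, 113), (199, 211), (389, 397), (761, 773), (1499, 1511), (2963, 2971)]
  have h_primes : ∀ a ∈ pairs, a.1.Prime ∧ a.2.Prime ∧ a.1 + 3 ≤ a.2 := by
    norm_num [pairs]
  have h_cover : ∃ a ∈ pairs, m < 2 * a.1 ∧ a.2 ≤ m := by
    simp only [pairs, List.exists_mem_cons_iff, List.not_mem_nil, false_and, exists_false]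
    omega
  obtain ⟨⟨p, q⟩, h_mem, hp, hq⟩ := h_cover
  obtain ⟨hp_prime, hq_prime, hpq⟩ := h_primes _ h_mem
  exact ⟨p, q, hp_prime, hq_prime, hp, hpq, hq⟩

/-! ### Sylow subgroups and transfer -/

section SylowPrimeOrder

variable {G : Type*} [Group G] {p : ℕ} {x : G}

theorem exists_sylow_coe_eq_zpowers [Finite G] [hp : Fact p.Prime] (hG : ¬ p ^ 2 ∣ Nat.card G)
    (hx : orderOf x = p) : ∃ P : Sylow p G, (P : Subgroup G) = Subgroup.zpowers x := by
  have h_factorization : (Nat.card G).factorization p = 1 := by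
    rw [hp.out.pow_dvd_iff_le_factorization Nat.card_pos.ne'] at hG
    have : p ∣ Nat.card G := hx ▸ orderOf_dvd_natCard x
    rw [hp.out.dvd_iff_one_le_factorization Nat.card_pos.ne'] at this
    omega
  exact ⟨Sylow.ofCard (Subgroup.zpowers x)
    (by rw [Nat.card_zpowers, hx, h_factorization, pow_one]), rfl⟩

theorem exists_conj_mem_of_pow_factorization_dvd [Finite G] (hp : p.Prime) {H : Subgroup G}
    (hH : p ^ (Nat.card G).factorization p ∣ Nat.card H) {z : G} (hz : orderOf z = p) :
    ∃ g : G, g * z * g⁻¹ ∈ H := by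
  have := Fact.mk hp
  obtain ⟨K, hK⟩ := Sylow.exists_subgroup_card_pow_prime p hH
  let P : Sylow p G := Sylow.ofCard (K.map H.subtype) (by
    rw [Subgroup.card_map_of_injective H.subtype_injective, hK])
  have hz_pGroup : IsPGroup p (Subgroup.zpowers z) := IsPGroup.of_card (n := 1) <| by
    rw [Nat.card_zpowers, hz, pow_one]
  obtain ⟨Q, hQ⟩ := hz_pGroup.exists_le_sylow
  obtain ⟨g, hg⟩ := exists_smul_eq G Q P
  refine ⟨g, Subgroup.map_subtype_le K ?_⟩
  change MulAut.conj g • z ∈ (P : Subgroup G)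
  rw [← hg, Sylow.coe_subgroup_smul]
  exact Subgroup.smul_mem_pointwise_smul z _ _ (hQ (Subgroup.mem_zpowers z))

theorem exists_conj_mem_zpowers [Finite G] (hp : p.Prime) (hG : ¬ p ^ 2 ∣ Nat.card G)
    (hx : orderOf x = p) {z : G} (hz : orderOf z = p) :
    ∃ g : G, g * z * g⁻¹ ∈ Subgroup.zpowers x := by
  refine exists_conj_mem_of_pow_factorization_dvd hp ?_ hz
  rw [hp.pow_dvd_iff_le_factorization Nat.card_pos.ne', not_le] at hG
  rw [Nat.card_zpowers, hx]
  exact (pow_dvd_pow p (Nat.lt_succ_iff.1 hG)).trans (pow_one p).dvd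

theorem commute_commutator_of_semiconjBy_zpow {a b : G} {k l : ℤ} (ha : SemiconjBy a x (x ^ k))
    (hb : SemiconjBy b x (x ^ l)) : Commute ((b * a)⁻¹ * (a * b)) x := by
  have hab : SemiconjBy (a * b) x (x ^ (k * l)) :=
    (zpow_mul x k l).symm ▸ (ha.zpow_right l).mul_left hb
  have hba : SemiconjBy (b * a) x (x ^ (k * l)) := by
    rw [mul_comm k l, zpow_mul]
    exact (hb.zpow_right k).mul_left ha
  exact hba.inv_symm_left.mul_left hab

-- The exponent `k` is a square root of `1` modulo `p`, by Fermat's little theorem.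
theorem semiconjBy_self_or_inv (hp : p.Prime) (hx : orderOf x = p) {g : G} {k : ℤ}
    (hg : SemiconjBy g x (x ^ k)) (h_gcd : (p - 1).gcd (orderOf g) ∣ 2) :
    SemiconjBy g x x ∨ SemiconjBy g x x⁻¹ := by
  have := Fact.mk hp
  have zpow_eq_zpow_iff (a b : ℤ) : x ^ a = x ^ b ↔ (a : ZMod p) = b := by
    rw [zpow_eq_zpow_iff_modEq, hx, ZMod.intCast_eq_intCast_iff]
  have h_pow (n : ℕ) : SemiconjBy (g ^ n) x (x ^ k ^ n) := by
    induction n with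
    | zero => simp
    | succ n ih =>
      rw [pow_succ' g, pow_succ' k, zpow_mul]
      exact (hg.zpow_right _).mul_left ih
  have h_pow_orderOf : (k : ZMod p) ^ orderOf g = 1 := by
    have h := h_pow (orderOf g)
    rw [pow_orderOf_eq_one, SemiconjBy, one_mul, mul_one, ← zpow_one x, ← zpow_mul, one_mul,
      zpow_eq_zpow_iff] at h
    exact_mod_cast h.symm
  have h_ne_zero : (k : ZMod p) ≠ 0 := by
    intro h
    rw [← Int.cast_zero, ← zpow_eq_zpow_iff, zpow_zero] at h
    rw [h, SemiconjBy, one_mul, mul_eq_left] at hg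
    exact hp.ne_one (by rw [← hx, hg, orderOf_one])
  have h_sq : (k : ZMod p) ^ 2 = 1 := by
    obtain ⟨c, hc⟩ := h_gcd
    rw [hc, pow_mul, pow_gcd_eq_one.2 ⟨ZMod.pow_card_sub_one_eq_one h_ne_zero, h_pow_orderOf⟩,
      one_pow]
  rcases sq_eq_one_iff.1 h_sq with h | h
  · left
    rwa [(zpow_eq_zpow_iff k 1).2 (by simpa using h), zpow_one] at hg
  · right
    rwa [(zpow_eq_zpow_iff k (-1)).2 (by simpa using h), zpow_neg_one] at hg

end SylowPrimeOrder

section Transfer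

variable {G : Type*} [Group G] [Finite G] {p : ℕ} [hp : Fact p.Prime]

theorem closure_ne_top_of_coprime_minFac (hG : (Nat.card G).minFac = p) (P : Sylow p G)
    [hP : IsCyclic P] {s : Set G} (hs : ∀ g ∈ s, (orderOf g).Coprime p) :
    Subgroup.closure s ≠ ⊤ := by
  let f := MonoidHom.transferSylow P (hP.normalizer_le_centralizer hG)
  have hs_le : Subgroup.closure s ≤ f.ker := by
    refine (Subgroup.closure_le _).2 fun g hg ↦ ?_
    obtain ⟨n, hn⟩ := P.2 (f g)
    rw [SetLike.mem_coe, MonoidHom.mem_ker, ← orderOf_eq_one_iff]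
    exact Nat.eq_one_of_dvd_coprimes ((hs g hg).pow_right n) (orderOf_map_dvd f g)
      (orderOf_dvd_of_pow_eq_one hn)
  intro h_top
  have h_dvd : p ∣ Nat.card f.ker := by
    rw [top_le_iff.1 (h_top.symm.trans_le hs_le), Subgroup.card_top, ← hG]
    exact Nat.minFac_dvd _
  exact MonoidHom.not_dvd_card_ker_transferSylow P _ h_dvd

theorem card_closure_ne_two_mul_odd {s : Set G} (hs : ∀ g ∈ s, Odd (orderOf g)) {k : ℕ}
    (hk : Odd k) : Nat.card (Subgroup.closure s) ≠ 2 * k := by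
  intro h_card
  have h_minFac : (Nat.card (Subgroup.closure s)).minFac = 2 := by
    rw [Nat.minFac_eq_two_iff, h_card]
    exact dvd_mul_right 2 k
  let P : Sylow 2 (Subgroup.closure s) := default
  have hP : IsCyclic P := by
    refine isCyclic_of_prime_card (p := 2) ?_
    rw [P.card_eq_multiplicity, h_card, Nat.factorization_mul two_ne_zero hk.pos.ne',
      Finsupp.add_apply, Nat.prime_two.factorization_self, Nat.factorization_eq_zero_of_not_dvd
        (by rwa [← even_iff_two_dvd, Nat.not_even_iff_odd])]
    norm_num
  refine closure_ne_top_of_coprime_minFac h_minFac P (fun g hg ↦ ?_)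
    (Subgroup.closure_closure_coe_preimage (k := s))
  rw [← Subgroup.orderOf_coe]
  exact Nat.coprime_two_right.2 (hs _ hg)

theorem index_closure_le_six {k : ℕ} (hk : Odd k) (hG : Nat.card G = 24 * k) {s : Set G}
    (hs : ∀ g ∈ s, Odd (orderOf g)) (h_dvd : 2 * k ∣ Nat.card (Subgroup.closure s)) :
    (Subgroup.closure s).index ≤ 6 := by
  obtain ⟨j, hj⟩ := h_dvd
  have h_mul : j * (Subgroup.closure s).index = 12 := by
    refine Nat.eq_of_mul_eq_mul_left (Nat.mul_pos two_pos hk.pos) ?_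
    rw [← mul_assoc, ← hj, Subgroup.card_mul_index, hG]
    ring
  have h_one : j ≠ 1 := by
    rintro rfl
    exact card_closure_ne_two_mul_odd hs hk (hj.trans (mul_one _))
  have h_pos : j ≠ 0 := by
    rintro rfl
    omega
  nlinarith [show 2 ≤ j by omega]

-- Frattini's argument inside the normal `p`-complement.
theorem exists_orderOf_mem_normalizer_isPGroup {r : ℕ} [hr : Fact r.Prime] (hrp : r ≠ p)
    (h_dvd_p : p ∣ Nat.card G) (h_dvd_r : r ∣ Nat.card G) (P : Sylow p G)
    (hP : Subgroup.normalizer P ≤ Subgroup.centralizer (P : Set G)) :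
    ∃ (z : G) (T : Subgroup G), orderOf z = p ∧ IsPGroup r T ∧ T ≠ ⊥ ∧
      z ∈ Subgroup.normalizer (T : Set G) := by
  let K : Subgroup G := (MonoidHom.transferSylow P hP).ker
  have hK : K.IsComplement' P := MonoidHom.ker_transferSylow_isComplement' P hP
  obtain ⟨n, hn⟩ := IsPGroup.iff_card.1 P.2
  have h_dvd_card : r ∣ Nat.card K := by
    rw [← hK.card_mul_card, hn, hr.out.dvd_mul] at h_dvd_r
    exact h_dvd_r.resolve_right fun h ↦
      hrp ((Nat.prime_dvd_prime_iff_eq hr.out hp.out).1 (hr.out.dvd_of_dvd_pow h))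
  have h_dvd_index : p ∣ K.index := by
    rw [← K.card_mul_index, hp.out.dvd_mul] at h_dvd_p
    exact h_dvd_p.resolve_left (MonoidHom.not_dvd_card_ker_transferSylow P hP)
  let Q : Sylow r K := default
  let T : Subgroup G := (Q : Subgroup K).map K.subtype
  have h_dvd_normalizer : p ∣ Nat.card (Subgroup.normalizer (T : Set G)) := by
    have h_frattini := Subgroup.relIndex_sup_right (Subgroup.normalizer (T : Set G)) K
    rw [Sylow.normalizer_sup_eq_top Q, Subgroup.relIndex_top_right] at h_frattini
    exact (h_frattini ▸ h_dvd_index).trans (Subgroup.relIndex_dvd_card _ _)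
  obtain ⟨z, hz⟩ := exists_prime_orderOf_dvd_card' p h_dvd_normalizer
  refine ⟨z, T, (Subgroup.orderOf_coe z).trans hz, Q.2.map _, fun hT ↦ ?_, z.2⟩
  exact Q.ne_bot_of_dvd_card h_dvd_card
    ((Subgroup.map_eq_bot_iff_of_injective _ K.subtype_injective).1 hT)

theorem exists_commute_of_mem_normalizer {z : G} (hz : orderOf z = p) {T : Subgroup G}
    (hzT : z ∈ Subgroup.normalizer (T : Set G)) (hT : ¬ Nat.card T ≡ 1 [MOD p]) :
    ∃ t ∈ T, t ≠ 1 ∧ Commute t z := by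
  let Z : Subgroup (Subgroup.normalizer (T : Set G)) := Subgroup.zpowers ⟨z, hzT⟩
  let _ : MulAction Z T := MulAction.compHom T (T.normalizerMonoidHom.comp Z.subtype)
  have hZ : IsPGroup p Z := IsPGroup.of_card (n := 1) <| by
    rw [Nat.card_zpowers, Subgroup.orderOf_mk, hz, pow_one]
  have h_card := hZ.card_modEq_card_fixedPoints T
  by_contra! h_trivial
  have h_card_one : Nat.card (fixedPoints Z T) = 1 := by
    refine Nat.card_eq_one_iff_exists.2 ⟨⟨1, fun g ↦ ?_⟩, fun t ↦ ?_⟩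
    · exact map_one (T.normalizerMonoidHom (g : Subgroup.normalizer (T : Set G)))
    · refine Subtype.ext (Subtype.ext (by_contra fun ht ↦ h_trivial t.1 t.1.2 ht ?_))
      have h_fixed : z * (t : T) * z⁻¹ = (t : T) :=
        congrArg Subtype.val (t.2 ⟨⟨z, hzT⟩, Subgroup.mem_zpowers _⟩)
      exact (mul_inv_eq_iff_eq_mul.1 h_fixed).symm
  exact hT (h_card_one ▸ h_card)

end Transfer

/-! ### Subgroups of small index in alternating groups -/

section SimpleGroup

variable {G : Type*} [Group G] [IsSimpleGroup G]

theorem toPermHom_quotient_injective {H : Subgroup G} (hH : H ≠ ⊤) :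
    Function.Injective (toPermHom G (G ⧸ H)) := by
  rw [← MonoidHom.ker_eq_bot_iff, ← Subgroup.normalCore_eq_ker]
  exact H.normalCore_normal.eq_bot_or_eq_top.resolve_right fun h ↦
    hH (top_le_iff.1 (h ▸ H.normalCore_le))

theorem card_dvd_factorial_index [Finite G] {H : Subgroup G} (hH : H ≠ ⊤) :
    Nat.card G ∣ H.index.factorial := by
  have := Subgroup.card_dvd_of_injective _ (toPermHom_quotient_injective hH)
  rwa [Nat.card_perm] at this

end SimpleGroup

section IsAlternatingGroup

variable {α : Type*} [Fintype α] [DecidableEq α] {H K : Type*} [Group H] [Group K]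

/-- `H` is isomorphic to an alternating group of degree at least `5`, i.e. to one of the simple
alternating groups other than the cyclic group `A₃`. -/
def IsAlternatingGroup (H : Type*) [Group H] : Prop :=
  ∃ d : ℕ, 5 ≤ d ∧ Nonempty (H ≃* alternatingGroup (Fin d))

theorem IsAlternatingGroup.of_mulEquiv (hK : IsAlternatingGroup K) (e : H ≃* K) :
    IsAlternatingGroup H := by
  obtain ⟨d, hd, ⟨f⟩⟩ := hK
  exact ⟨d, hd, ⟨e.trans f⟩⟩

theorem isAlternatingGroup_alternatingGroup (hα : 5 ≤ Nat.card α) :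
    IsAlternatingGroup (alternatingGroup α) :=
  ⟨Nat.card α, hα, ⟨Equiv.altCongrHom
    (Fintype.equivFinOfCardEq (Nat.card_eq_fintype_card (α := α)).symm)⟩⟩

theorem isAlternatingGroup_of_eq_top (hα : 5 ≤ Nat.card α) {H : Subgroup (alternatingGroup α)}
    (hH : H = ⊤) : IsAlternatingGroup H :=
  (isAlternatingGroup_alternatingGroup hα).of_mulEquiv <|
    (MulEquiv.subgroupCongr hH).trans Subgroup.topEquiv

theorem not_isSolvable_alternatingGroup (hα : 5 ≤ Nat.card α) :
    ¬ Group.IsSolvable (alternatingGroup α) := by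
  have := alternatingGroup.isSimpleGroup hα
  rw [← IsSimpleGroup.comm_iff_isSolvable]
  intro h_comm
  have := alternatingGroup.isMulCommutative_iff_card_le_three.1 ⟨⟨h_comm⟩⟩
  omega

theorem IsAlternatingGroup.not_isSolvable (hH : IsAlternatingGroup H) :
    ¬ Group.IsSolvable H := by
  obtain ⟨d, hd, ⟨e⟩⟩ := hH
  intro h_solvable
  exact not_isSolvable_alternatingGroup (by rwa [Nat.card_fin])
    (Group.isSolvable_of_surjective (f := e.toMonoidHom) e.surjective)

theorem card_le_index_of_ne_top (hα : 5 ≤ Nat.card α) {H : Subgroup (alternatingGroup α)}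
    (hH : H ≠ ⊤) : Nat.card α ≤ H.index := by
  have := alternatingGroup.isSimpleGroup hα
  have : Nontrivial α := Finite.one_lt_card_iff_nontrivial.1 (by omega)
  by_contra! h_lt
  have h_card : Nat.card (alternatingGroup α) ≤ (Nat.card α - 1).factorial :=
    Nat.le_of_dvd (Nat.factorial_pos _)
      ((card_dvd_factorial_index hH).trans (Nat.factorial_dvd_factorial (by omega)))
  have h_two_mul := two_mul_nat_card_alternatingGroup (α := α)
  rw [Nat.card_perm, ← Nat.mul_factorial_pred (by omega)] at h_two_mul
  nlinarith [(Nat.card α - 1).factorial_pos]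

theorem range_ofSubtype_erase (a : α) :
    (alternatingGroup.ofSubtype (Finset.univ.erase a)).range =
      stabilizer (alternatingGroup α) a := by
  ext g
  simp only [alternatingGroup.mem_range_ofSubtype_iff, Finset.subset_erase, Finset.subset_univ,
    true_and, notMem_support, mem_stabilizer_iff, Subgroup.smul_def, Perm.smul_def]

theorem isAlternatingGroup_stabilizer (hα : 6 ≤ Nat.card α) (a : α) :
    IsAlternatingGroup (stabilizer (alternatingGroup α) a) := by
  have h_card : 5 ≤ Nat.card (Finset.univ.erase a) := by
    rw [Nat.card_eq_fintype_card, Fintype.card_coe, Finset.card_erase_of_mem (Finset.mem_univ a),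
      Finset.card_univ, ← Nat.card_eq_fintype_card]
    omega
  exact (isAlternatingGroup_alternatingGroup h_card).of_mulEquiv <|
    (MulEquiv.subgroupCongr (range_ofSubtype_erase a)).symm.trans
      (MonoidHom.ofInjective alternatingGroup.ofSubtype_injective).symm

-- The action on cosets is an isomorphism onto the alternating group of the coset space, and
-- carries the subgroup to a point stabilizer.
theorem isAlternatingGroup_of_index_eq_card (hα : 6 ≤ Nat.card α)
    {H : Subgroup (alternatingGroup α)} (hH : H.index = Nat.card α) : IsAlternatingGroup H := by
  classical
  have := alternatingGroup.isSimpleGroup (α := α) (by omega)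
  have : Nontrivial α := Finite.one_lt_card_iff_nontrivial.1 (by omega)
  let Ω := alternatingGroup α ⧸ H
  have : Fintype Ω := Fintype.ofFinite Ω
  have hΩ : Nat.card Ω = Nat.card α := hH
  have h_ne_top : H ≠ ⊤ := by
    rintro rfl
    rw [Subgroup.index_top] at hH
    omega
  let φ : alternatingGroup α →* Perm Ω := toPermHom (alternatingGroup α) Ω
  have hφ : Function.Injective φ := toPermHom_quotient_injective h_ne_top
  have h_range : φ.range = alternatingGroup Ω := by
    refine eq_alternatingGroup_of_index_eq_two
      (Nat.eq_of_mul_eq_mul_left (Nat.card_pos (α := φ.range)) ?_)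
    rw [φ.range.card_mul_index, ← Nat.card_congr (MonoidHom.ofInjective hφ).toEquiv, Nat.card_perm,
      hΩ, ← Nat.card_perm, ← two_mul_nat_card_alternatingGroup, mul_comm]
  let ψ : alternatingGroup α ≃* alternatingGroup Ω :=
    (MonoidHom.ofInjective hφ).trans (MulEquiv.subgroupCongr h_range)
  have h_map : H.map ψ.toMonoidHom =
      stabilizer (alternatingGroup Ω) ((1 : alternatingGroup α) : Ω) := by
    ext g
    obtain ⟨g, rfl⟩ := ψ.surjective g
    have h_smul : ψ g • ((1 : alternatingGroup α) : Ω) = (g : Ω) :=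
      congrArg QuotientGroup.mk (mul_one g)
    rw [mem_stabilizer_iff, h_smul, eq_comm, QuotientGroup.eq, inv_one, one_mul]
    exact Subgroup.mem_map_iff_mem ψ.injective
  exact (isAlternatingGroup_stabilizer (hΩ.symm ▸ hα) _).of_mulEquiv <|
    (H.equivMapOfInjective ψ.toMonoidHom ψ.injective).trans (MulEquiv.subgroupCongr h_map)

theorem isAlternatingGroup_of_index_le_card (hα : 6 ≤ Nat.card α)
    {H : Subgroup (alternatingGroup α)} (hH : H.index ≤ Nat.card α) : IsAlternatingGroup H := by
  by_cases h_top : H = ⊤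
  · exact isAlternatingGroup_of_eq_top (by omega) h_top
  · exact isAlternatingGroup_of_index_eq_card hα
      (hH.antisymm (card_le_index_of_ne_top (by omega) h_top))

end IsAlternatingGroup

/-! ### Permutations of prime order and Jordan's theorem -/

theorem not_sq_dvd_factorial {p n : ℕ} (hp : p.Prime) (hn : n < 2 * p) :
    ¬ p ^ 2 ∣ n.factorial := by
  have hp_two := hp.two_le
  have h_log : Nat.log p n < 2 := Nat.log_lt_of_lt_pow' two_ne_zero (by nlinarith)
  have h_div : n / p < 2 := Nat.div_lt_of_lt_mul (by rwa [mul_comm])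
  rw [hp.pow_dvd_iff_le_factorization n.factorial_ne_zero, Nat.factorization_factorial hp h_log,
    Nat.Ico_succ_singleton, Finset.sum_singleton, pow_one]
  omega

section Support

variable {α : Type*} [Fintype α] [DecidableEq α]

theorem mem_fixingSubgroup_compl_iff_support_subset {s : Finset α} {g : Perm α} :
    g ∈ fixingSubgroup (Perm α) (s : Set α)ᶜ ↔ g.support ⊆ s := by
  simp only [mem_fixingSubgroup_iff, Set.mem_compl_iff, Finset.mem_coe, Perm.smul_def,
    Finset.subset_iff, mem_support]
  exact forall_congr' fun a ↦ not_imp_comm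

theorem card_fixingSubgroup_compl {α : Type*} [Finite α] (s : Finset α) :
    Nat.card (fixingSubgroup (Perm α) (s : Set α)ᶜ) = s.card.factorial := by
  classical
  have := Fintype.ofFinite α
  have h_range : (ofSubtype : Perm s →* Perm α).range = fixingSubgroup (Perm α) (s : Set α)ᶜ := by
    ext g
    rw [mem_fixingSubgroup_compl_iff_support_subset]
    exact mem_range_ofSubtype_iff
  rw [← h_range, ← Nat.card_congr (MonoidHom.ofInjective ofSubtype_injective).toEquiv,
    Nat.card_perm, Nat.card_eq_fintype_card, Fintype.card_coe]

theorem exists_cycleType_eq_replicate {x : Perm α} {p : ℕ} (hp : p.Prime) (hx : orderOf x = p) :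
    ∃ n : ℕ, x.cycleType = Multiset.replicate (n + 1) p ∧ x.support.card = (n + 1) * p := by
  obtain ⟨n, hn⟩ := cycleType_prime_order (hx ▸ hp)
  rw [hx] at hn
  exact ⟨n, hn, by rw [← sum_cycleType, hn, Multiset.sum_replicate, smul_eq_mul]⟩

theorem isCycle_and_card_support_of_card_support_lt {x : Perm α} {p : ℕ} (hp : p.Prime)
    (hx : orderOf x = p) (h_lt : x.support.card < 2 * p) : x.IsCycle ∧ x.support.card = p := by
  obtain ⟨n, h_type, h_card⟩ := exists_cycleType_eq_replicate hp hx
  obtain rfl : n = 0 := by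
    have := Nat.lt_of_mul_lt_mul_right (h_card ▸ h_lt)
    omega
  rw [zero_add, one_mul] at h_card
  exact ⟨card_cycleType_eq_one.1 (by rw [h_type, Multiset.card_replicate]), h_card⟩

end Support

section CommutingPermutations

variable {α : Type*} {c x : Perm α} {a : α}

theorem pow_orderOf_apply_eq_self_of_sameCycle (h : Commute c x) (ha : SameCycle x a (c a)) :
    (c ^ orderOf x) a = a := by
  obtain ⟨i, hi⟩ := ha
  have h_fixed : (x ^ (-i) * c) a = a := by
    rw [mul_apply, ← hi, ← mul_apply, ← zpow_add, neg_add_cancel, zpow_zero, one_apply]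
  have := pow_apply_eq_self_of_apply_eq_self h_fixed (orderOf x)
  rwa [(h.symm.zpow_left (-i)).mul_pow, ← zpow_natCast, ← zpow_mul, mul_comm, zpow_mul,
    zpow_natCast, pow_orderOf_eq_one, one_zpow, one_mul] at this

theorem apply_ne_self_of_commute (h : Commute c x) (ha : x a ≠ a) : x (c a) ≠ c a := by
  rw [← mul_apply, ← h.eq, mul_apply]
  exact c.injective.ne ha

variable [Fintype α] [DecidableEq α]

theorem pow_orderOf_eq_one_of_commute_isCycle (h : Commute c x) (hx : x.IsCycle)
    (h_support : c.support ⊆ x.support) : c ^ orderOf x = 1 := by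
  ext a
  by_cases ha : x a = a
  · exact pow_apply_eq_self_of_apply_eq_self
      (notMem_support.1 fun hc ↦ mem_support.1 (h_support hc) ha) _
  · exact pow_orderOf_apply_eq_self_of_sameCycle h
      (hx.sameCycle ha (apply_ne_self_of_commute h ha))

-- Among `a`, `c a` and `c² a`, two lie in the same cycle of `x`.
theorem pow_two_mul_eq_one_of_commute (h : Commute c x) {p : ℕ} (hp : p.Prime)
    (hx : orderOf x = p) (h_lt : x.support.card < 3 * p) (h_support : c.support ⊆ x.support) :
    c ^ (2 * p) = 1 := by
  have h_cycles : ¬ 2 < x.cycleFactorsFinset.card := by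
    obtain ⟨n, h_type, h_card⟩ := exists_cycleType_eq_replicate hp hx
    rw [h_card] at h_lt
    have := lt_of_mul_lt_mul_right h_lt (Nat.zero_le p)
    rw [Finset.card_def, ← Multiset.card_map (Finset.card ∘ support), ← cycleType_def, h_type,
      Multiset.card_replicate]
    omega
  ext a
  by_cases ha : x a = a
  · exact pow_apply_eq_self_of_apply_eq_self
      (notMem_support.1 fun hc ↦ mem_support.1 (h_support hc) ha) _
  have ha₁ := apply_ne_self_of_commute h ha
  have ha₂ := apply_ne_self_of_commute h ha₁
  have h_sameCycle : SameCycle x a (c a) ∨ SameCycle x a (c (c a)) ∨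
      SameCycle x (c a) (c (c a)) := by
    replace ha := mem_support.2 ha
    replace ha₁ := mem_support.2 ha₁
    replace ha₂ := mem_support.2 ha₂
    rw [sameCycle_iff_cycleOf_eq_of_mem_support ha ha₁,
      sameCycle_iff_cycleOf_eq_of_mem_support ha ha₂,
      sameCycle_iff_cycleOf_eq_of_mem_support ha₁ ha₂]
    by_contra! h_ne
    exact h_cycles (Finset.two_lt_card.2 ⟨_, cycleOf_mem_cycleFactorsFinset_iff.2 ha,
      _, cycleOf_mem_cycleFactorsFinset_iff.2 ha₁, _, cycleOf_mem_cycleFactorsFinset_iff.2 ha₂,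
      h_ne⟩)
  rw [one_apply, ← hx]
  rcases h_sameCycle with h₁ | h₂ | h₁
  · rw [mul_comm, pow_mul]
    exact pow_apply_eq_self_of_apply_eq_self (pow_orderOf_apply_eq_self_of_sameCycle h h₁) 2
  · rw [pow_mul]
    exact pow_orderOf_apply_eq_self_of_sameCycle (h.pow_left 2) h₂
  · have h_fixed := pow_orderOf_apply_eq_self_of_sameCycle h h₁
    rw [← mul_apply, ← pow_succ, pow_succ', mul_apply, c.injective.eq_iff] at h_fixed
    rw [mul_comm, pow_mul]
    exact pow_apply_eq_self_of_apply_eq_self h_fixed 2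

end CommutingPermutations

theorem commutator_mul_mul_of_commute {G : Type*} [Group G] {a b c d : G} (hac : Commute a c)
    (had : Commute a d) (hbc : Commute b c) (hbd : Commute b d) :
    ((b * d) * (a * c))⁻¹ * ((a * c) * (b * d)) =
        ((b * a)⁻¹ * (a * b)) * ((d * c)⁻¹ * (c * d)) ∧
      Commute ((b * a)⁻¹ * (a * b)) ((d * c)⁻¹ * (c * d)) := by
  have h_ab {g : G} (hga : Commute a g) (hgb : Commute b g) : Commute ((b * a)⁻¹ * (a * b)) g :=
    (hgb.mul_left hga).inv_left.mul_left (hga.mul_left hgb)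
  refine ⟨?_, (h_ab (had.mul_right hac) (hbd.mul_right hbc)).inv_right.mul_right
    (h_ab (hac.mul_right had) (hbc.mul_right hbd))⟩
  have h_dc : Commute (a * b) (d * c)⁻¹ :=
    ((had.mul_right hac).mul_left (hbd.mul_right hbc)).inv_right
  calc ((b * d) * (a * c))⁻¹ * ((a * c) * (b * d))
      = ((b * a) * (d * c))⁻¹ * ((a * b) * (c * d)) := by
        rw [had.symm.mul_mul_mul_comm, hbc.symm.mul_mul_mul_comm]
    _ = ((b * a)⁻¹ * (d * c)⁻¹) * ((a * b) * (c * d)) := by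
        rw [((hbd.mul_right hbc).mul_left (had.mul_right hac)).mul_inv]
    _ = ((b * a)⁻¹ * (a * b)) * ((d * c)⁻¹ * (c * d)) := h_dc.symm.mul_mul_mul_comm _ _

section NormalizerLift

variable {α : Type*} {G : Subgroup (Perm α)}

theorem exists_mem_forall_mem_apply_eq {s : Finset α}
    (hG : IsMultiplyPretransitive G α s.card) (σ : Perm α) :
    ∃ g ∈ G, ∀ a ∈ s, g a = σ a := by
  let e : Fin s.card ↪ α := s.equivFin.symm.toEmbedding.trans (Function.Embedding.subtype _)
  obtain ⟨g, hg⟩ := exists_smul_eq G e (e.trans σ.toEmbedding)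
  refine ⟨g, g.2, fun a ha ↦ ?_⟩
  have h_apply := DFunLike.congr_fun hg (s.equivFin ⟨a, ha⟩)
  simpa [e] using! h_apply

variable [Fintype α] [DecidableEq α] {x σ : Perm α} {p : ℕ}

theorem disjoint_swap_of_notMem_support {a b : α} (ha : a ∉ x.support) (hb : b ∉ x.support) :
    (swap a b).Disjoint x := by
  intro c
  by_cases hc : x c = c
  · exact Or.inr hc
  · replace hc := mem_support.2 hc
    exact Or.inl (swap_apply_of_ne_of_ne (ne_of_mem_of_not_mem hc ha) (ne_of_mem_of_not_mem hc hb))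

-- A preimage `g ∈ G` of `σ` conjugates `x` within its support, so Sylow's theorem corrects `g` to
-- normalize `⟨x⟩` without changing it off the support.
theorem exists_mul_mem_and_semiconjBy_zpow (hxG : x ∈ G) (hp : p.Prime) (hx : orderOf x = p)
    (hG : IsMultiplyPretransitive G α x.supportᶜ.card)
    (h_card : ¬ p ^ 2 ∣ Nat.card (G ⊓ fixingSubgroup (Perm α) (x.support : Set α)ᶜ : Subgroup _))
    (hσ : σ.Disjoint x) :
    ∃ e : Perm α, e.support ⊆ x.support ∧ σ * e ∈ G ∧ ∃ k : ℤ, SemiconjBy e x (x ^ k) := by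
  let K := fixingSubgroup (Perm α) (x.support : Set α)ᶜ
  have hK {f : Perm α} : f ∈ K ↔ f.support ⊆ x.support :=
    mem_fixingSubgroup_compl_iff_support_subset
  obtain ⟨g, hgG, hg⟩ := exists_mem_forall_mem_apply_eq hG σ
  let u := σ⁻¹ * g
  have hu : u ∈ K := hK.2 fun a ha ↦ by
    by_contra hax
    exact mem_support.1 ha (by rw [mul_apply, hg a (Finset.mem_compl.2 hax), inv_eq_iff_eq])
  have hx_mem : x ∈ G ⊓ K := Subgroup.mem_inf.2 ⟨hxG, hK.2 subset_rfl⟩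
  have hK_conj : u * x * u⁻¹ ∈ K := K.mul_mem (K.mul_mem hu hx_mem.2) (K.inv_mem hu)
  have h_conj : g * x * g⁻¹ = u * x * u⁻¹ :=
    calc g * x * g⁻¹ = σ * (u * x * u⁻¹) * σ⁻¹ := by simp only [u]; group
      _ = u * x * u⁻¹ := by
        rw [(hσ.mono subset_rfl (hK.1 hK_conj)).commute.eq, mul_inv_cancel_right]
  have h_conj_mem : u * x * u⁻¹ ∈ G ⊓ K :=
    Subgroup.mem_inf.2 ⟨h_conj ▸ G.mul_mem (G.mul_mem hgG hxG) (G.inv_mem hgG), hK_conj⟩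
  obtain ⟨h, k, hk⟩ := exists_conj_mem_zpowers (G := ↥(G ⊓ K)) hp h_card (x := ⟨x, hx_mem⟩)
    (z := ⟨u * x * u⁻¹, h_conj_mem⟩) (by rw [Subgroup.orderOf_mk, hx])
    (by rw [Subgroup.orderOf_mk, ← hx]; exact (MulAut.conj u).orderOf_eq x)
  replace hk : x ^ k = h * (u * x * u⁻¹) * (h : Perm α)⁻¹ := congrArg Subtype.val hk
  have hσh : Commute σ h := (hσ.mono subset_rfl (hK.1 h.2.2)).commute
  refine ⟨h * u, hK.1 (K.mul_mem h.2.2 hu), ?_, k, ?_⟩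
  · have h_eq : σ * (h * u) = h * g := by
      rw [← mul_assoc, hσh.eq, mul_assoc, mul_inv_cancel_left]
    exact h_eq ▸ G.mul_mem h.2.1 hgG
  · rw [SemiconjBy, hk]
    group

theorem exists_isThreeCycle_mem_of_isMultiplyPretransitive (hxG : x ∈ G) (hp : p.Prime)
    (hp_ne : p ≠ 3) (hx : orderOf x = p) (h_support : x.support.card < 3 * p)
    (h_fixed : 3 ≤ x.supportᶜ.card) (hG : IsMultiplyPretransitive G α x.supportᶜ.card)
    (h_card : ¬ p ^ 2 ∣ Nat.card (G ⊓ fixingSubgroup (Perm α) (x.support : Set α)ᶜ : Subgroup _)) :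
    ∃ g ∈ G, g.IsThreeCycle := by
  obtain ⟨a, ha, b, hb, c, hc, hab, hac, hbc⟩ := Finset.two_lt_card.1 h_fixed
  rw [Finset.mem_compl] at ha hb hc
  let σ₁ := swap a b
  let σ₂ := swap a c
  have hσ₁ : σ₁.Disjoint x := disjoint_swap_of_notMem_support ha hb
  have hσ₂ : σ₂.Disjoint x := disjoint_swap_of_notMem_support ha hc
  obtain ⟨e₁, he₁, h_mem₁, k₁, hk₁⟩ := exists_mul_mem_and_semiconjBy_zpow hxG hp hx hG h_card hσ₁
  obtain ⟨e₂, he₂, h_mem₂, k₂, hk₂⟩ := exists_mul_mem_and_semiconjBy_zpow hxG hp hx hG h_card hσ₂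
  let t := (σ₂ * σ₁)⁻¹ * (σ₁ * σ₂)
  let e := (e₂ * e₁)⁻¹ * (e₁ * e₂)
  have h_commute {σ f : Perm α} (hσ : σ.Disjoint x) (hf : f.support ⊆ x.support) : Commute σ f :=
    (hσ.mono subset_rfl hf).commute
  obtain ⟨h_eq, hte⟩ := commutator_mul_mul_of_commute (h_commute hσ₁ he₁) (h_commute hσ₁ he₂)
    (h_commute hσ₂ he₁) (h_commute hσ₂ he₂)
  have ht : t.IsThreeCycle := by
    simp only [t, σ₁, σ₂, mul_inv_rev, swap_inv]
    exact (isThreeCycle_swap_mul_swap_same hab hac hbc).isThreeCycle_sq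
  have he : e ^ (2 * p) = 1 := by
    refine pow_two_mul_eq_one_of_commute (commute_commutator_of_semiconjBy_zpow hk₁ hk₂) hp hx
      h_support ?_
    simp only [← mem_fixingSubgroup_compl_iff_support_subset] at he₁ he₂ ⊢
    exact mul_mem (inv_mem (mul_mem he₂ he₁)) (mul_mem he₁ he₂)
  refine ⟨t ^ (2 * p), ?_, ?_⟩
  · rw [← mul_one (t ^ (2 * p)), ← he, ← hte.mul_pow, ← h_eq]
    exact pow_mem (mul_mem (inv_mem (mul_mem h_mem₂ h_mem₁)) (mul_mem h_mem₁ h_mem₂)) _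
  · rw [← card_support_eq_three_iff, support_pow_coprime, ht.card_support]
    rw [ht.orderOf, Nat.coprime_comm]
    exact Nat.Coprime.mul_right (by norm_num)
      ((Nat.coprime_primes Nat.prime_three hp).2 hp_ne.symm)

end NormalizerLift

section PrimeCycle

variable {α : Type*} [Fintype α] [DecidableEq α] {G : Subgroup (Perm α)} {g : Perm α}

theorem card_support_add_card_support_compl (g : Perm α) :
    g.support.card + g.supportᶜ.card = Nat.card α := by
  rw [Finset.card_add_card_compl, Nat.card_eq_fintype_card]

theorem isPreprimitive_fixingSubgroup_of_isCycle_mem (hg : g ∈ G) (h_cycle : g.IsCycle)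
    (h_prime : g.support.card.Prime) :
    IsPreprimitive (fixingSubgroup G (g.support : Set α)ᶜ)
      (SubMulAction.ofFixingSubgroup G (g.support : Set α)ᶜ) := by
  have := isPretransitive_of_isCycle_mem h_cycle hg
  apply IsPreprimitive.of_prime_card
  have h_card : Nat.card (SubMulAction.ofFixingSubgroup G (g.support : Set α)ᶜ) =
      g.support.card := by
    rw [← Set.ncard_coe_finset, ← Nat.card_coe_set_eq]
    exact Nat.card_congr (Equiv.subtypeEquivRight fun a ↦ by
      simp only [SubMulAction.mem_ofFixingSubgroup_iff, Set.mem_compl_iff, not_not])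
  rwa [h_card]

theorem isPreprimitive_of_isCycle_mem [IsPretransitive G α] (hg : g ∈ G) (h_cycle : g.IsCycle)
    (h_prime : g.support.card.Prime) (h_lt : Nat.card α < 2 * g.support.card) :
    IsPreprimitive G α := by
  have := isPreprimitive_fixingSubgroup_of_isCycle_mem hg h_cycle h_prime
  let f : SubMulAction.ofFixingSubgroup G (g.support : Set α)ᶜ
      →ₑ[(fixingSubgroup G (g.support : Set α)ᶜ).subtype] α :=
    { toFun := Subtype.val, map_smul' := fun _ _ ↦ rfl }
  have h_range : Set.range f = (g.support : Set α) :=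
    Subtype.range_coe.trans <| Set.ext fun a ↦ by
      simp only [SetLike.mem_coe, SubMulAction.mem_ofFixingSubgroup_iff, Set.mem_compl_iff,
        not_not]
  exact IsPreprimitive.of_card_lt (f := f) (by rwa [h_range, Set.ncard_coe_finset])

theorem isMultiplyPretransitive_of_isCycle_mem (hG : IsPreprimitive G α) (hg : g ∈ G)
    (h_cycle : g.IsCycle) (h_prime : g.support.card.Prime) {k : ℕ}
    (h_fixed : g.supportᶜ.card = k + 1) : IsMultiplyPretransitive G α (k + 2) := by
  have h_ncard : ((g.support : Set α)ᶜ).ncard = k + 1 := by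
    rw [← Finset.coe_compl, Set.ncard_coe_finset, h_fixed]
  have h_card := card_support_add_card_support_compl g
  have h_two := h_prime.two_le
  exact (hG.isMultiplyPreprimitive h_ncard (by omega)
    (isPreprimitive_fixingSubgroup_of_isCycle_mem hg h_cycle h_prime)).isMultiplyPretransitive

theorem alternatingGroup_le_of_isPreprimitive_of_isCycle_mem (hG : IsPreprimitive G α)
    (hg : g ∈ G) (h_cycle : g.IsCycle) (h_prime : g.support.card.Prime)
    (h_fixed : g.support.card + 3 ≤ Nat.card α) : alternatingGroup α ≤ G := by
  by_cases h_three : g.support.card = 3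
  · exact alternatingGroup_le_of_isPreprimitive_of_isThreeCycle_mem hG
      (card_support_eq_three_iff.1 h_three) hg
  have h_card := card_support_add_card_support_compl g
  obtain ⟨k, hk⟩ : ∃ k, g.supportᶜ.card = k + 1 := ⟨g.supportᶜ.card - 1, by omega⟩
  have h_two := h_prime.two_le
  have := isMultiplyPretransitive_of_isCycle_mem hG hg h_cycle h_prime hk
  have h_trans : IsMultiplyPretransitive G α g.supportᶜ.card :=
    isMultiplyPretransitive_of_le (n := k + 2) (by omega) (by omega)
  have h_sylow : ¬ g.support.card ^ 2 ∣
      Nat.card (G ⊓ fixingSubgroup (Perm α) (g.support : Set α)ᶜ : Subgroup _) := fun h ↦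
    not_sq_dvd_factorial h_prime (by omega) <|
      card_fixingSubgroup_compl g.support ▸ h.trans (Subgroup.card_dvd_of_le inf_le_right)
  obtain ⟨t, ht, ht_three⟩ := exists_isThreeCycle_mem_of_isMultiplyPretransitive hg h_prime h_three
    h_cycle.orderOf (by omega) (by omega) h_trans h_sylow
  exact alternatingGroup_le_of_isPreprimitive_of_isThreeCycle_mem hG ht_three ht

end PrimeCycle

theorem descFactorial_dvd_card_of_isMultiplyPretransitive {G α : Type*} [Group G] [Finite α]
    [MulAction G α] {k : ℕ} (hG : IsMultiplyPretransitive G α k) (hk : k ≤ Nat.card α) :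
    (Nat.card α).descFactorial k ∣ Nat.card G := by
  obtain ⟨s, -, hs⟩ := Set.exists_subset_card_eq (s := (Set.univ : Set α)) (n := k)
    (by rwa [Set.ncard_univ])
  have h_index := IsMultiplyPretransitive.index_of_fixingSubgroup_eq (G := G) s (by rwa [hs])
  rw [hs, mul_comm, ← Nat.descFactorial_eq_factorial_mul_choose] at h_index
  exact h_index ▸ Subgroup.index_dvd_card _

section TransitiveClosure

variable {α : Type*} [Fintype α] [DecidableEq α] {x y : Perm α} {p : ℕ}

theorem card_support_cycleOf (hp : p.Prime) (hx : orderOf x = p) {c : α} (hc : x c ≠ c) :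
    (x.cycleOf c).support.card = p := by
  have h_cycle := isCycle_cycleOf x hc
  rw [← h_cycle.orderOf]
  exact ((Nat.dvd_prime hp).1 (hx ▸ orderOf_cycleOf_dvd_orderOf x c)).resolve_left
    (mt orderOf_eq_one_iff.1 h_cycle.ne_one)

theorem isPretransitive_closure_pair (hp : p.Prime) (hx : orderOf x = p) (hy : y.IsCycle)
    (h_lt : Nat.card α < p + y.support.card) (h_cover : x.support ∪ y.support = Finset.univ) :
    IsPretransitive (Subgroup.closure {x, y}) α := by
  have hx_mem : x ∈ Subgroup.closure {x, y} := Subgroup.mem_closure_of_mem (Set.mem_insert x {y})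
  have hy_mem : y ∈ Subgroup.closure {x, y} :=
    Subgroup.mem_closure_of_mem (Set.mem_insert_of_mem x rfl)
  obtain ⟨b, hb, -⟩ := id hy
  have h_orbit {c : α} (hc : y c ≠ c) : ∃ g ∈ Subgroup.closure {x, y}, g b = c := by
    obtain ⟨i, hi⟩ := hy.exists_pow_eq hb hc
    exact ⟨y ^ i, pow_mem hy_mem i, hi⟩
  refine (isPretransitive_iff_base b).2 fun c ↦ ?_
  suffices ∃ g ∈ Subgroup.closure {x, y}, g b = c by
    obtain ⟨g, hg, rfl⟩ := this
    exact ⟨⟨g, hg⟩, rfl⟩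
  by_cases hc : y c = c
  · have hcx : x c ≠ c := by
      have := h_cover ▸ Finset.mem_univ c
      exact mem_support.1 ((Finset.mem_union.1 this).resolve_right (notMem_support.2 hc))
    obtain ⟨d, hd, hdy⟩ : ∃ d ∈ (x.cycleOf c).support, d ∈ y.support := by
      by_contra! h_disjoint
      have h_card := Finset.card_union_of_disjoint (Finset.disjoint_left.2 h_disjoint)
      rw [card_support_cycleOf hp hx hcx] at h_card
      have h_le := Finset.card_le_univ ((x.cycleOf c).support ∪ y.support)
      rw [← Nat.card_eq_fintype_card] at h_le
      omega
    obtain ⟨i, hi⟩ := (mem_support_cycleOf_iff.1 hd).1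
    obtain ⟨g, hg, hgd⟩ := h_orbit (mem_support.1 hdy)
    exact ⟨x ^ (-i) * g, mul_mem (zpow_mem hx_mem _) hg, by
      rw [mul_apply, hgd, ← hi, ← mul_apply, ← zpow_add, neg_add_cancel, zpow_zero, one_apply]⟩
  · exact h_orbit hc

end TransitiveClosure

/-! ### Degree thirteen -/

section Inversion

variable {α : Type*} {n x z : Perm α}

theorem zpow_apply_of_semiconjBy_inv (h : SemiconjBy n x x⁻¹) (k : ℤ) (a : α) :
    n ((x ^ k) a) = (x ^ (-k)) (n a) := by
  rw [← mul_apply, (h.zpow_right k).eq, inv_zpow', mul_apply]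

variable [Fintype α] [DecidableEq α]

theorem mem_support_apply_of_semiconjBy (h : SemiconjBy n x z) {a : α} (ha : a ∈ x.support) :
    n a ∈ z.support := by
  rw [mem_support, ← mul_apply, ← h.eq, mul_apply, n.injective.ne_iff]
  exact mem_support.1 ha

theorem sq_eq_one_of_semiconjBy_inv_of_isCycle (h : SemiconjBy n x x⁻¹) (hx : x.IsCycle)
    (h_support : n.support ⊆ x.support) : n ^ 2 = 1 := by
  ext a
  by_cases ha : a ∈ x.support
  · have hna := mem_support_apply_of_semiconjBy h ha
    rw [support_inv] at hna
    obtain ⟨k, hk⟩ := hx.exists_zpow_eq (mem_support.1 ha) (mem_support.1 hna)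
    rw [pow_two, mul_apply, ← hk, zpow_apply_of_semiconjBy_inv h, ← hk, ← mul_apply, ← zpow_add,
      neg_add_cancel, zpow_zero]
  · exact pow_apply_eq_self_of_apply_eq_self (notMem_support.1 fun hna ↦ ha (h_support hna)) 2

theorem card_support_sdiff_le_one_of_semiconjBy_inv (h : SemiconjBy n x x⁻¹) (hx : x.IsCycle)
    (h_odd : Odd x.support.card) : (x.support \ n.support).card ≤ 1 := by
  refine Finset.card_le_one.2 fun a ha b hb ↦ ?_
  simp only [Finset.mem_sdiff, notMem_support] at ha hb
  obtain ⟨k, rfl⟩ := hx.exists_pow_eq (mem_support.1 ha.1) (mem_support.1 hb.1)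
  have h_inv : (x ^ (-(k : ℤ))) a = (x ^ k) a := by
    rw [← hb.2, ← zpow_natCast, zpow_apply_of_semiconjBy_inv h, ha.2]
  have h_fixed : (x ^ (2 * k)) a = a := by
    rw [two_mul, pow_add, mul_apply, ← h_inv, ← zpow_natCast, ← mul_apply, ← zpow_add,
      add_neg_cancel, zpow_zero, one_apply]
  have h_dvd : orderOf x ∣ 2 * k :=
    orderOf_dvd_iff_pow_eq_one.2 (hx.pow_eq_one_iff.2 ⟨a, mem_support.1 ha.1, h_fixed⟩)
  have h_coprime : (orderOf x).Coprime 2 := by rwa [hx.orderOf, Nat.coprime_two_right]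
  rw [orderOf_dvd_iff_pow_eq_one.1 (h_coprime.dvd_of_dvd_mul_left h_dvd), one_apply]

theorem card_support_add_one_of_semiconjBy_inv (h : SemiconjBy n x x⁻¹) (hx : x.IsCycle)
    (h_odd : Odd x.support.card) (h_support : n.support ⊆ x.support) :
    n.support.card + 1 = x.support.card := by
  have h_even := two_dvd_card_support (sq_eq_one_of_semiconjBy_inv_of_isCycle h hx h_support)
  have h_le := card_support_sdiff_le_one_of_semiconjBy_inv h hx h_odd
  have h_add := Finset.card_sdiff_add_card_eq_card h_support
  obtain ⟨k, hk⟩ := h_odd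
  omega

theorem notMem_alternatingGroup_of_semiconjBy_inv (h : SemiconjBy n x x⁻¹) (hx : x.IsCycle)
    (h_mod : x.support.card % 4 = 3) (h_support : n.support ⊆ x.support) :
    n ∉ alternatingGroup α := by
  have h_card := card_support_add_one_of_semiconjBy_inv h hx
    (Nat.odd_iff.2 (by omega)) h_support
  have h_sum : n.cycleType.sum = n.support.card := sum_cycleType n
  rw [mem_alternatingGroup, sign_of_pow_two_eq_one
    (sq_eq_one_of_semiconjBy_inv_of_isCycle h hx h_support), card_fixedPoints,
    h_sum, Nat.sub_sub_self (Finset.card_le_univ _), Odd.neg_one_pow (Nat.odd_iff.2 (by omega))]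
  decide

theorem support_subset_of_semiconjBy_of_apply_eq_self (h : SemiconjBy n x z)
    (hz : z.support = x.support) (h_card : x.supportᶜ.card = 2) {a : α} (hxa : x a = a)
    (hna : n a = a) : n.support ⊆ x.support := by
  intro c hc
  by_contra hcx
  have h_ne : c ≠ a := by
    rintro rfl
    exact mem_support.1 hc hna
  have h_ne' : n c ≠ a := fun h_eq ↦ h_ne (n.injective (h_eq.trans hna.symm))
  have hncx : n c ∉ x.support := by
    rw [← hz, notMem_support, ← mul_apply, ← h.eq, mul_apply, notMem_support.1 hcx]
  have h_two_lt : 2 < x.supportᶜ.card := Finset.two_lt_card.2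
    ⟨a, Finset.mem_compl.2 (notMem_support.2 hxa), c, Finset.mem_compl.2 hcx, n c,
      Finset.mem_compl.2 hncx, h_ne.symm, h_ne'.symm, (mem_support.1 hc).symm⟩
  omega

end Inversion

theorem normalizer_zpowers_le_centralizer {G : Type*} [Group G] {x : G}
    (h : ∀ (n : G) (k : ℤ), SemiconjBy n x (x ^ k) → Commute n x) :
    Subgroup.normalizer (Subgroup.zpowers x : Set G) ≤
      Subgroup.centralizer (Subgroup.zpowers x : Set G) := by
  intro n hn
  obtain ⟨k, hk⟩ := (Subgroup.mem_normalizer_iff.1 hn x).1 (Subgroup.mem_zpowers x)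
  have h_commute : Commute n x := h n k (eq_mul_inv_iff_mul_eq.1 hk).symm
  rw [Subgroup.mem_centralizer_iff]
  rintro _ ⟨l, rfl⟩
  exact (h_commute.zpow_right l).eq.symm

section TwoFixedPoints

variable {α : Type*} [Fintype α] [DecidableEq α] {n x : Perm α} {p : ℕ} {a : α}

theorem isCycle_and_card_support_of_card_eq_add_two (hp : p.Prime) (h_two_lt : 2 < p)
    (h_card : Nat.card α = p + 2) (hx : orderOf x = p) :
    x.IsCycle ∧ x.support.card = p ∧ x.supportᶜ.card = 2 := by
  have h_add := card_support_add_card_support_compl x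
  obtain ⟨h_cycle, h_support⟩ :=
    isCycle_and_card_support_of_card_support_lt hp hx (by omega)
  exact ⟨h_cycle, h_support, by omega⟩

theorem commute_of_semiconjBy_zpow_of_mem_alternatingGroup (hp : p.Prime) (h_mod : p % 4 = 3)
    (h_card : Nat.card α = p + 2) (hx : orderOf x = p) (hxa : x a = a)
    (hn : n ∈ alternatingGroup α) (hna : n a = a) {k : ℤ} (h : SemiconjBy n x (x ^ k))
    (h_gcd : (p - 1).gcd (orderOf n) ∣ 2) : Commute n x := by
  obtain ⟨h_cycle, h_support, h_fixed⟩ :=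
    isCycle_and_card_support_of_card_eq_add_two hp (by omega) h_card hx
  refine (semiconjBy_self_or_inv hp hx h h_gcd).resolve_right fun h_inv ↦ ?_
  exact notMem_alternatingGroup_of_semiconjBy_inv h_inv h_cycle (h_support ▸ h_mod)
    (support_subset_of_semiconjBy_of_apply_eq_self h_inv (support_inv x) h_fixed hxa hna) hn

theorem pow_eq_one_of_commute_of_apply_eq_self {α : Type*} {t z : Perm α} {a : α}
    (hp : p.Prime) (h_two_lt : 2 < p) (h_card : Nat.card α = p + 2) (hz : orderOf z = p)
    (hza : z a = a) (hta : t a = a) (h : Commute t z) : t ^ p = 1 := by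
  classical
  have : Finite α := Nat.finite_of_card_ne_zero (by omega)
  have := Fintype.ofFinite α
  obtain ⟨h_cycle, -, h_fixed⟩ :=
    isCycle_and_card_support_of_card_eq_add_two hp h_two_lt h_card hz
  rw [← hz]
  exact pow_orderOf_eq_one_of_commute_isCycle h h_cycle
    (support_subset_of_semiconjBy_of_apply_eq_self h rfl h_fixed hza hta)

theorem exists_isPGroup_card_modEq_one {S : Subgroup (Perm α)} (hS : S ≤ alternatingGroup α)
    (hSa : ∀ g ∈ S, g a = a) (hp : p.Prime) (h_mod : p % 4 = 3) (h_card : Nat.card α = p + 2)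
    (hxS : x ∈ S) (hx : orderOf x = p) (h_gcd : (p - 1).gcd (Nat.card S) ∣ 2) {r : ℕ}
    [hr : Fact r.Prime] (hrp : r ≠ p) (h_dvd : r ∣ Nat.card S) :
    ∃ T : Subgroup S, IsPGroup r T ∧ T ≠ ⊥ ∧ Nat.card T ≡ 1 [MOD p] := by
  have := Fact.mk hp
  let x' : S := ⟨x, hxS⟩
  have hx' : orderOf x' = p := (Subgroup.orderOf_mk x hxS).trans hx
  have h_sylow : ¬ p ^ 2 ∣ Nat.card S := fun h ↦
    not_sq_dvd_factorial (n := p + 2) hp (by omega) <|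
      h_card ▸ Nat.card_perm (α := α) ▸ h.trans S.card_subgroup_dvd_card
  obtain ⟨P, hP⟩ := exists_sylow_coe_eq_zpowers h_sylow hx'
  have h_normalizer : Subgroup.normalizer P ≤ Subgroup.centralizer (P : Set S) := by
    rw [← P.coe_coe, hP]
    refine normalizer_zpowers_le_centralizer fun n k h ↦ Subtype.ext ?_
    refine (commute_of_semiconjBy_zpow_of_mem_alternatingGroup hp h_mod h_card hx (hSa x hxS)
      (hS n.2) (hSa n n.2) (h.map S.subtype) ?_).eq
    rw [Subgroup.orderOf_coe]
    exact (Nat.gcd_dvd_gcd_of_dvd_right _ (orderOf_dvd_natCard n)).trans h_gcd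
  obtain ⟨z, T, hz, hT, hT_ne, hzT⟩ :=
    exists_orderOf_mem_normalizer_isPGroup hrp (hx' ▸ orderOf_dvd_natCard x') h_dvd P h_normalizer
  refine ⟨T, hT, hT_ne, ?_⟩
  by_contra hT_card
  obtain ⟨t, htT, ht_ne, htz⟩ := exists_commute_of_mem_normalizer hz hzT hT_card
  have ht_pow : t ^ p = 1 := Subtype.ext <|
    pow_eq_one_of_commute_of_apply_eq_self hp (by omega) h_card
      ((Subgroup.orderOf_coe z).trans hz) (hSa z z.2) (hSa t t.2) (htz.map S.subtype)
  have h_coprime : (orderOf t).Coprime p := by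
    rw [← Subgroup.orderOf_mk t htT]
    exact hT.orderOf_coprime ((Nat.coprime_primes hr.out hp).2 hrp) _
  exact ht_ne (orderOf_eq_one_iff.1 (h_coprime.eq_one_of_dvd (orderOf_dvd_of_pow_eq_one ht_pow)))

end TwoFixedPoints

theorem card_pred_dvd_card_stabilizer {G α : Type*} [Group G] [Finite α] [MulAction G α]
    (hG : IsMultiplyPretransitive G α 2) (h_card : 2 ≤ Nat.card α) (a : α) :
    Nat.card α - 1 ∣ Nat.card (stabilizer G a) := by
  have : IsPretransitive G α := isPretransitive_of_is_two_pretransitive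
  have h_dvd := descFactorial_dvd_card_of_isMultiplyPretransitive hG h_card
  rw [← (stabilizer G a).index_mul_card, index_stabilizer_of_transitive, Nat.descFactorial_succ,
    Nat.descFactorial_one, mul_comm] at h_dvd
  exact Nat.dvd_of_mul_dvd_mul_left (by omega) h_dvd

theorem exists_isCycle_mem_of_pow_factorization_dvd {α : Type*} [Fintype α] [DecidableEq α]
    {G : Subgroup (Perm α)} {p : ℕ} (hp : p.Prime) (hα : p ≤ Nat.card α)
    (hG : p ^ (Nat.card (Perm α)).factorization p ∣ Nat.card G) :
    ∃ g ∈ G, g.IsCycle ∧ g.support.card = p := by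
  obtain ⟨τ, hτ⟩ : ∃ τ : Perm α, τ.cycleType = {p} := by
    rw [exists_with_cycleType_iff, Multiset.sum_singleton, ← Nat.card_eq_fintype_card]
    exact ⟨hα, fun n hn ↦ Multiset.mem_singleton.1 hn ▸ hp.two_le⟩
  have hτ_cycle : τ.IsCycle := card_cycleType_eq_one.1 (by rw [hτ, Multiset.card_singleton])
  have hτ_card : τ.support.card = p := by rw [← sum_cycleType, hτ, Multiset.sum_singleton]
  obtain ⟨g, hg⟩ := exists_conj_mem_of_pow_factorization_dvd hp hG (hτ_cycle.orderOf.trans hτ_card)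
  exact ⟨_, hg, hτ_cycle.conj, by rw [card_support_conj, hτ_card]⟩

section DegreeThirteen

variable {α : Type*} [Fintype α] [DecidableEq α] {G : Subgroup (Perm α)} {x : Perm α}

theorem two_pow_ten_not_dvd_card_alternatingGroup (h_card : Nat.card α = 13) :
    ¬ 2 ^ 10 ∣ Nat.card (alternatingGroup α) := by
  have : Nontrivial α := Finite.one_lt_card_iff_nontrivial.1 (by omega)
  intro h_dvd
  have h_dvd_factorial : 2 * 2 ^ 10 ∣ (13).factorial := by
    rw [← h_card, ← Nat.card_perm, ← two_mul_nat_card_alternatingGroup]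
    exact mul_dvd_mul_left 2 h_dvd
  revert h_dvd_factorial
  decide

theorem five_dvd_card_of_card_eq_thirteen (hG : G ≤ alternatingGroup α)
    (h_trans : IsMultiplyPretransitive G α 2) (h_card : Nat.card α = 13) (hxG : x ∈ G)
    (hx : orderOf x = 11) : 5 ∣ Nat.card G := by
  have h_eleven : Nat.Prime 11 := by norm_num
  have := Fact.mk Nat.prime_two
  by_contra h_five
  obtain ⟨-, -, h_fixed⟩ :=
    isCycle_and_card_support_of_card_eq_add_two h_eleven (by norm_num) h_card hx
  obtain ⟨a, ha⟩ : x.supportᶜ.Nonempty := Finset.card_pos.1 (by omega)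
  rw [Finset.mem_compl, notMem_support] at ha
  let S : Subgroup (Perm α) := (stabilizer G a).map G.subtype
  have hSG : S ≤ G := Subgroup.map_subtype_le _
  have h_gcd : (11 - 1).gcd (Nat.card S) ∣ 2 := by
    have h_coprime : ((11 - 1).gcd (Nat.card S)).Coprime 5 := by
      rw [Nat.coprime_comm, Nat.prime_five.coprime_iff_not_dvd]
      exact fun h ↦ h_five (h.trans ((Nat.gcd_dvd_right _ _).trans (Subgroup.card_dvd_of_le hSG)))
    exact h_coprime.dvd_of_dvd_mul_right (n := 5) (Nat.gcd_dvd_left _ _)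
  have h_two_dvd : 2 ∣ Nat.card S := by
    rw [Subgroup.card_map_of_injective G.subtype_injective]
    have := card_pred_dvd_card_stabilizer h_trans (by omega) a
    rw [h_card] at this
    exact Dvd.dvd.trans (by norm_num) this
  obtain ⟨T, hT, hT_ne, hT_card⟩ := exists_isPGroup_card_modEq_one (hSG.trans hG)
    (by rintro _ ⟨g, hg, rfl⟩; exact hg) h_eleven rfl h_card ⟨⟨x, hxG⟩, ha, rfl⟩ hx h_gcd
    (by norm_num : 2 ≠ 11) h_two_dvd
  obtain ⟨i, hi⟩ := IsPGroup.iff_card.1 hT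
  have hi_lt : i < 10 := by
    by_contra! hi_le
    refine two_pow_ten_not_dvd_card_alternatingGroup h_card ((pow_dvd_pow 2 hi_le).trans ?_)
    exact hi ▸ T.card_subgroup_dvd_card.trans (Subgroup.card_dvd_of_le (hSG.trans hG))
  have hi_ne : i ≠ 0 := by
    rintro rfl
    exact hT_ne (Subgroup.card_eq_one.1 hi)
  rw [hi] at hT_card
  interval_cases i <;> revert hT_card hi_ne <;> decide

theorem alternatingGroup_le_of_card_eq_thirteen_of_five_dvd (hG : IsPreprimitive G α)
    (h_trans : IsMultiplyPretransitive G α 3) (h_card : Nat.card α = 13) (h_dvd : 5 ∣ Nat.card G) :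
    alternatingGroup α ≤ G := by
  have h_jordan {g : Perm α} (hg : g ∈ G) (hg_cycle : g.IsCycle) (hg_card : g.support.card = 5) :
      alternatingGroup α ≤ G :=
    alternatingGroup_le_of_isPreprimitive_of_isCycle_mem hG hg hg_cycle
      (hg_card ▸ Nat.prime_five) (by omega)
  have := Fact.mk Nat.prime_five
  by_cases h_sq_dvd : 5 ^ 2 ∣ Nat.card G
  · have h_factorization : (Nat.card (Perm α)).factorization 5 ≤ 2 := by
      rw [Nat.card_perm, h_card, Nat.factorization_factorial (b := 2) Nat.prime_five (by norm_num)]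
      decide
    obtain ⟨g, hg, hg_cycle, hg_card⟩ := exists_isCycle_mem_of_pow_factorization_dvd
      Nat.prime_five (by omega) ((pow_dvd_pow 5 h_factorization).trans h_sq_dvd)
    exact h_jordan hg hg_cycle hg_card
  · obtain ⟨u, hu⟩ := exists_prime_orderOf_dvd_card' 5 h_dvd
    rw [← Subgroup.orderOf_coe] at hu
    obtain ⟨n, h_type, h_support⟩ := exists_cycleType_eq_replicate Nat.prime_five hu
    have h_add := card_support_add_card_support_compl (u : Perm α)
    obtain rfl | rfl : n = 0 ∨ n = 1 := by omega
    · exact h_jordan u.2 (card_cycleType_eq_one.1 (by rw [h_type, Multiset.card_replicate]))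
        h_support
    · have h_fixed : (u : Perm α).supportᶜ.card = 3 := by omega
      obtain ⟨g, hg, hg_three⟩ := exists_isThreeCycle_mem_of_isMultiplyPretransitive u.2
        Nat.prime_five (by norm_num) hu (by omega) h_fixed.ge (by rwa [h_fixed])
        (fun h ↦ h_sq_dvd (h.trans (Subgroup.card_dvd_of_le inf_le_left)))
      exact alternatingGroup_le_of_isPreprimitive_of_isThreeCycle_mem hG hg_three hg

theorem alternatingGroup_le_of_card_eq_thirteen (hG : IsPreprimitive G α)
    (hG_le : G ≤ alternatingGroup α) (h_card : Nat.card α = 13) (hxG : x ∈ G)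
    (hx : orderOf x = 11) : alternatingGroup α ≤ G := by
  have h_eleven : Nat.Prime 11 := by norm_num
  obtain ⟨h_cycle, h_support, h_fixed⟩ :=
    isCycle_and_card_support_of_card_eq_add_two h_eleven (by norm_num) h_card hx
  have h_three : IsMultiplyPretransitive G α 3 :=
    isMultiplyPretransitive_of_isCycle_mem hG hxG h_cycle (h_support ▸ h_eleven) h_fixed
  have h_two : IsMultiplyPretransitive G α 2 :=
    isMultiplyPretransitive_of_le (n := 3) (by omega) (by omega)
  exact alternatingGroup_le_of_card_eq_thirteen_of_five_dvd hG h_three h_card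
    (five_dvd_card_of_card_eq_thirteen hG_le h_two h_card hxG hx)

end DegreeThirteen

/-! ### Pairs of permutations of prime orders -/

section ClosurePair

variable {α : Type*} [Fintype α] [DecidableEq α]

theorem map_subtype_closure_pair (x y : alternatingGroup α) :
    (Subgroup.closure {x, y}).map (alternatingGroup α).subtype =
      Subgroup.closure {(x : Perm α), (y : Perm α)} := by
  rw [MonoidHom.map_closure, Set.image_pair]
  rfl

theorem closure_pair_eq_top {x y : alternatingGroup α}
    (h : alternatingGroup α ≤ Subgroup.closure {(x : Perm α), (y : Perm α)}) :
    Subgroup.closure {x, y} = ⊤ := by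
  rw [← map_subtype_closure_pair] at h
  exact top_le_iff.1 fun g _ ↦
    (Subgroup.mem_map_iff_mem (alternatingGroup α).subtype_injective).1 (h g.2)

theorem isAlternatingGroup_closure_pair_of_isMultiplyPretransitive (hα : 6 ≤ Nat.card α)
    {x y : alternatingGroup α} (hx : Odd (orderOf x)) (hy : Odd (orderOf y)) {n k : ℕ}
    (h_trans : IsMultiplyPretransitive (Subgroup.closure {(x : Perm α), (y : Perm α)}) α n)
    (hn : n ≤ Nat.card α) (hk : Odd k) (h_factorial : (Nat.card α).factorial = 2 * (24 * k))
    (h_descFactorial : (Nat.card α).descFactorial n = 2 * k) :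
    IsAlternatingGroup (Subgroup.closure {x, y}) := by
  have : Nontrivial α := Finite.one_lt_card_iff_nontrivial.1 (by omega)
  have h_card : Nat.card (alternatingGroup α) = 24 * k := by
    have := two_mul_nat_card_alternatingGroup (α := α)
    rw [Nat.card_perm, h_factorial] at this
    omega
  refine isAlternatingGroup_of_index_le_card hα (le_trans ?_ hα)
  refine index_closure_le_six hk h_card (by rintro g (rfl | rfl) <;> assumption) ?_
  rw [← h_descFactorial, ← Subgroup.card_map_of_injective (alternatingGroup α).subtype_injective,
    map_subtype_closure_pair]
  exact descFactorial_dvd_card_of_isMultiplyPretransitive h_trans hn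

/-- `x` and `y` have prime orders `p < q`, and every point is moved by `x` or `y`. As the degree is
at most `2 * p`, it is less than `2 * q`, so that `y` is a single `q`-cycle. -/
structure IsCoveringPair (p q : ℕ) (x y : Perm α) : Prop where
  prime_left : p.Prime
  prime_right : q.Prime
  lt : p < q
  orderOf_left : orderOf x = p
  orderOf_right : orderOf y = q
  card_le : Nat.card α ≤ 2 * p
  support_union : x.support ∪ y.support = Finset.univ

namespace IsCoveringPair

section Perm

variable {p q : ℕ} {x y : Perm α}

theorem isCycle_and_card_support_right (h : IsCoveringPair p q x y) :
    y.IsCycle ∧ y.support.card = q := by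
  have := card_support_add_card_support_compl y
  have := h.card_le
  have := h.lt
  exact isCycle_and_card_support_of_card_support_lt h.prime_right h.orderOf_right (by omega)

theorem le_card (h : IsCoveringPair p q x y) : q ≤ Nat.card α := by
  have := card_support_add_card_support_compl y
  have := h.isCycle_and_card_support_right.2
  omega

theorem isPreprimitive (h : IsCoveringPair p q x y) :
    IsPreprimitive (Subgroup.closure {x, y}) α := by
  obtain ⟨h_cycle, h_support⟩ := h.isCycle_and_card_support_right
  have := h.card_le
  have := h.lt
  have := isPretransitive_closure_pair h.prime_left h.orderOf_left h_cycle (by omega)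
    h.support_union
  exact isPreprimitive_of_isCycle_mem (Subgroup.mem_closure_of_mem (Set.mem_insert_of_mem x rfl))
    h_cycle (h_support ▸ h.prime_right) (by omega)

end Perm

variable {p q : ℕ} {x y : alternatingGroup α}

theorem isAlternatingGroup_of_le (h : IsCoveringPair p q (x : Perm α) y) (hq : 5 ≤ q)
    (h_le : alternatingGroup α ≤ Subgroup.closure {(x : Perm α), (y : Perm α)}) :
    IsAlternatingGroup (Subgroup.closure {x, y}) :=
  isAlternatingGroup_of_eq_top (hq.trans h.le_card) (closure_pair_eq_top h_le)

theorem isAlternatingGroup_of_add_three_le (h : IsCoveringPair p q (x : Perm α) y) (hq : 5 ≤ q)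
    (h_lt : (x : Perm α).support.card < 2 * p) (h_add : p + 3 ≤ Nat.card α) :
    IsAlternatingGroup (Subgroup.closure {x, y}) := by
  obtain ⟨h_cycle, h_support⟩ :=
    isCycle_and_card_support_of_card_support_lt h.prime_left h.orderOf_left h_lt
  exact h.isAlternatingGroup_of_le hq <| alternatingGroup_le_of_isPreprimitive_of_isCycle_mem
    h.isPreprimitive (Subgroup.mem_closure_of_mem (Set.mem_insert _ _)) h_cycle
    (h_support ▸ h.prime_left) (by omega)

theorem isAlternatingGroup_of_gap (h : IsCoveringPair p q (x : Perm α) y) (h_gap : p + 3 ≤ q)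
    (h_lt : Nat.card α < 2 * p) : IsAlternatingGroup (Subgroup.closure {x, y}) := by
  have := h.prime_left.two_le
  have := card_support_add_card_support_compl (x : Perm α)
  exact h.isAlternatingGroup_of_add_three_le (by omega) (by omega) (h_gap.trans h.le_card)

theorem isAlternatingGroup_three_five (h : IsCoveringPair 3 5 (x : Perm α) y) :
    IsAlternatingGroup (Subgroup.closure {x, y}) := by
  have h_add := card_support_add_card_support_compl (x : Perm α)
  have h_card_le := h.card_le
  rcases lt_or_ge (x : Perm α).support.card (2 * 3) with h_lt | h_ge
  · obtain ⟨-, h_support⟩ :=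
      isCycle_and_card_support_of_card_support_lt h.prime_left h.orderOf_left h_lt
    exact h.isAlternatingGroup_of_le le_rfl <|
      alternatingGroup_le_of_isPreprimitive_of_isThreeCycle_mem h.isPreprimitive
        (card_support_eq_three_iff.1 h_support) (Subgroup.mem_closure_of_mem (Set.mem_insert _ _))
  · have h_card : Nat.card α = 6 := by omega
    obtain ⟨h_cycle, h_support⟩ := h.isCycle_and_card_support_right
    have h_fixed := card_support_add_card_support_compl (y : Perm α)
    have h_trans := isMultiplyPretransitive_of_isCycle_mem h.isPreprimitive
      (Subgroup.mem_closure_of_mem (Set.mem_insert_of_mem _ rfl)) h_cycle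
      (h_support ▸ h.prime_right) (k := 0) (by omega)
    refine isAlternatingGroup_closure_pair_of_isMultiplyPretransitive (k := 15) h_card.ge
      ?_ ?_ h_trans (by omega) (by decide) (by rw [h_card]; rfl) (by rw [h_card]; rfl)
    · rw [← Subgroup.orderOf_coe, h.orderOf_left]
      decide
    · rw [← Subgroup.orderOf_coe, h.orderOf_right]
      decide

theorem isAlternatingGroup_five_seven (h : IsCoveringPair 5 7 (x : Perm α) y) :
    IsAlternatingGroup (Subgroup.closure {x, y}) := by
  have h_add := card_support_add_card_support_compl (x : Perm α)
  have h_card_le := h.card_le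
  rcases lt_or_ge (x : Perm α).support.card (2 * 5) with h_lt | h_ge
  · rcases h.le_card.eq_or_lt' with h_card | h_card_lt
    · obtain ⟨h_cycle, h_support⟩ :=
        isCycle_and_card_support_of_card_support_lt h.prime_left h.orderOf_left h_lt
      have h_trans := isMultiplyPretransitive_of_isCycle_mem h.isPreprimitive
        (Subgroup.mem_closure_of_mem (Set.mem_insert _ _)) h_cycle
        (h_support ▸ h.prime_left) (k := 1) (by omega)
      refine isAlternatingGroup_closure_pair_of_isMultiplyPretransitive (k := 105) (by omega)
        ?_ ?_ h_trans (by omega) (by decide) (by rw [h_card]; rfl) (by rw [h_card]; rfl)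
      · rw [← Subgroup.orderOf_coe, h.orderOf_left]
        decide
      · rw [← Subgroup.orderOf_coe, h.orderOf_right]
        decide
    · exact h.isAlternatingGroup_of_add_three_le (by norm_num) h_lt h_card_lt
  · obtain ⟨h_cycle, h_support⟩ := h.isCycle_and_card_support_right
    exact h.isAlternatingGroup_of_le (by norm_num) <|
      alternatingGroup_le_of_isPreprimitive_of_isCycle_mem h.isPreprimitive
        (Subgroup.mem_closure_of_mem (Set.mem_insert_of_mem _ rfl)) h_cycle
        (h_support ▸ h.prime_right) (by omega)

theorem isAlternatingGroup_eleven_thirteen (h : IsCoveringPair 11 13 (x : Perm α) y)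
    (h_lt : Nat.card α < 22) : IsAlternatingGroup (Subgroup.closure {x, y}) := by
  rcases h.le_card.eq_or_lt' with h_card | h_card_lt
  · have h_le : Subgroup.closure {(x : Perm α), (y : Perm α)} ≤ alternatingGroup α :=
      (Subgroup.closure_le _).2 (Set.pair_subset x.2 y.2)
    exact h.isAlternatingGroup_of_le (by norm_num) <|
      alternatingGroup_le_of_card_eq_thirteen h.isPreprimitive h_le h_card
        (Subgroup.mem_closure_of_mem (Set.mem_insert _ _)) h.orderOf_left
  · have := card_support_add_card_support_compl (x : Perm α)
    exact h.isAlternatingGroup_of_add_three_le (by norm_num) (by omega) h_card_lt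

end IsCoveringPair

theorem exists_ofSubtype_eq_and_support_union_eq_univ (x y : alternatingGroup α) :
    ∃ (s : Finset α) (x' y' : alternatingGroup s), alternatingGroup.ofSubtype s x' = x ∧
      alternatingGroup.ofSubtype s y' = y ∧
      (x' : Perm s).support ∪ (y' : Perm s).support = Finset.univ := by
  let s := (x : Perm α).support ∪ (y : Perm α).support
  obtain ⟨x', hx'⟩ := (alternatingGroup.mem_range_ofSubtype_iff s x).2 Finset.subset_union_left
  obtain ⟨y', hy'⟩ := (alternatingGroup.mem_range_ofSubtype_iff s y).2 Finset.subset_union_right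
  refine ⟨s, x', y', hx', hy', Finset.eq_univ_iff_forall.2 fun ⟨a, ha⟩ ↦ ?_⟩
  have h_apply (z : alternatingGroup s) :
      (alternatingGroup.ofSubtype s z : Perm α) a = (z : Perm s) ⟨a, ha⟩ :=
    Perm.ofSubtype_apply_of_mem _ ha
  simp only [s, Finset.mem_union, mem_support] at ha
  rw [← hx', ← hy', h_apply, h_apply] at ha
  simpa only [Finset.mem_union, mem_support, ne_eq, Subtype.ext_iff] using ha

theorem isAlternatingGroup_closure_pair_of_forall_isCoveringPair {p q : ℕ} (hp : p.Prime)
    (hq : q.Prime) (h_lt : p < q) (hα : Nat.card α ≤ 2 * p)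
    (h : ∀ (s : Finset α) (x y : alternatingGroup s), IsCoveringPair p q (x : Perm s) y →
      IsAlternatingGroup (Subgroup.closure {x, y}))
    {x y : alternatingGroup α} (hx : orderOf x = p) (hy : orderOf y = q) :
    IsAlternatingGroup (Subgroup.closure {x, y}) := by
  obtain ⟨s, x', y', rfl, rfl, h_cover⟩ := exists_ofSubtype_eq_and_support_union_eq_univ x y
  have h_inj : Function.Injective (alternatingGroup.ofSubtype s) :=
    alternatingGroup.ofSubtype_injective
  rw [orderOf_injective _ h_inj, ← Subgroup.orderOf_coe] at hx hy
  have h_closure : (Subgroup.closure {x', y'}).map (alternatingGroup.ofSubtype s) =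
      Subgroup.closure {alternatingGroup.ofSubtype s x', alternatingGroup.ofSubtype s y'} := by
    rw [MonoidHom.map_closure, Set.image_pair]
  have h_pair : IsCoveringPair p q (x' : Perm s) y' :=
    ⟨hp, hq, h_lt, hx, hy, (Finite.card_subtype_le _).trans hα, h_cover⟩
  exact (h s x' y' h_pair).of_mulEquiv <| (MulEquiv.subgroupCongr h_closure).symm.trans
    (Subgroup.equivMapOfInjective _ _ h_inj).symm

end ClosurePair

/-- The primes `p < q` lie in the range prescribed for degree `m`, and any two elements of `A_m` of
orders `p` and `q` generate an alternating group of degree at least `5`. -/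
structure IsGeneratingPair (m p q : ℕ) : Prop where
  prime_left : p.Prime
  prime_right : q.Prime
  le_two_mul : m ≤ 2 * p
  lt_two_mul : m ≠ 6 → m ≠ 10 → m < 2 * p
  lt : p < q
  le : q ≤ m
  isAlternatingGroup (x y : alternatingGroup (Fin m)) : orderOf x = p → orderOf y = q →
    IsAlternatingGroup (Subgroup.closure {x, y})

theorem isGeneratingPair_of_forall_isCoveringPair {m p q : ℕ} (hp : p.Prime) (hq : q.Prime)
    (h_le_two_mul : m ≤ 2 * p) (h_lt_two_mul : m ≠ 6 → m ≠ 10 → m < 2 * p) (h_lt : p < q)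
    (h_le : q ≤ m) (h : ∀ (s : Finset (Fin m)) (x y : alternatingGroup s), Nat.card s ≤ m →
      IsCoveringPair p q (x : Perm s) y → IsAlternatingGroup (Subgroup.closure {x, y})) :
    IsGeneratingPair m p q := by
  refine ⟨hp, hq, h_le_two_mul, h_lt_two_mul, h_lt, h_le, fun x y ↦ ?_⟩
  refine isAlternatingGroup_closure_pair_of_forall_isCoveringPair hp hq h_lt
    ((Nat.card_fin m).trans_le h_le_two_mul) fun s x y h_pair ↦ h s x y ?_ h_pair
  exact (Finite.card_subtype_le _).trans_eq (Nat.card_fin m)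

theorem isGeneratingPair_of_gap {m p q : ℕ} (hp : p.Prime) (hq : q.Prime) (h_lt : m < 2 * p)
    (h_gap : p + 3 ≤ q) (h_le : q ≤ m) : IsGeneratingPair m p q :=
  isGeneratingPair_of_forall_isCoveringPair hp hq h_lt.le (fun _ _ ↦ h_lt) (by omega) h_le
    fun _ _ _ h_card h_pair ↦ h_pair.isAlternatingGroup_of_gap h_gap (h_card.trans_lt h_lt)

theorem exists_isGeneratingPair (m : ℕ) (hm : 5 ≤ m) : ∃ p q : ℕ, IsGeneratingPair m p q := by
  obtain h | h | h | h | h : 17 ≤ m ∨ (14 ≤ m ∧ m ≤ 16) ∨ (11 ≤ m ∧ m ≤ 13) ∨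
      (7 ≤ m ∧ m ≤ 10) ∨ m ≤ 6 := by omega
  · obtain ⟨p, q, hp, hq, h_lt, h_gap, h_le⟩ := exists_primes_add_three_le h
    exact ⟨p, q, isGeneratingPair_of_gap hp hq h_lt h_gap h_le⟩
  · refine ⟨11, 13, isGeneratingPair_of_forall_isCoveringPair (by norm_num) (by norm_num)
      (by omega) (by omega) (by omega) (by omega) fun s x y h_card h_pair ↦ ?_⟩
    exact h_pair.isAlternatingGroup_eleven_thirteen (by omega)
  · exact ⟨7, 11, isGeneratingPair_of_gap (by norm_num) (by norm_num) (by omega) (by omega) h.1⟩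
  · exact ⟨5, 7, isGeneratingPair_of_forall_isCoveringPair (by norm_num) (by norm_num)
      (by omega) (by omega) (by omega) (by omega)
      fun _ _ _ _ h_pair ↦ h_pair.isAlternatingGroup_five_seven⟩
  · exact ⟨3, 5, isGeneratingPair_of_forall_isCoveringPair (by norm_num) (by norm_num)
      (by omega) (by omega) (by omega) (by omega)
      fun _ _ _ _ h_pair ↦ h_pair.isAlternatingGroup_three_five⟩

theorem proposition3p4 (m : ℕ) (hm : 5 ≤ m) :
    ∃ p q : ℕ, p.Prime ∧ q.Prime ∧
      (m : ℚ) / 2 ≤ p ∧ (m ≠ 6 → m ≠ 10 → (m : ℚ) / 2 < p) ∧ p < q ∧ q ≤ m ∧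
      ∀ x y : alternatingGroup (Fin m), orderOf x = p → orderOf y = q →
        (∃ d : ℕ, 5 ≤ d ∧
          Nonempty (Subgroup.closure ({x, y} : Set (alternatingGroup (Fin m))) ≃*
            alternatingGroup (Fin d))) ∧
        ¬ Group.IsSolvable (Subgroup.closure ({x, y} : Set (alternatingGroup (Fin m)))) := by
  obtain ⟨p, q, h⟩ := exists_isGeneratingPair m hm
  refine ⟨p, q, h.prime_left, h.prime_right, ?_, fun h_six h_ten ↦ ?_, h.lt, h.le,
    fun x y hx hy ↦ ?_⟩
  · rw [div_le_iff₀' two_pos]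
    exact_mod_cast h.le_two_mul
  · rw [div_lt_iff₀' two_pos]
    exact_mod_cast h.lt_two_mul h_six h_ten
  · have h_alternating := h.isAlternatingGroup x y hx hy
    exact ⟨h_alternating, h_alternating.not_isSolvable⟩
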